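/- Let $M$ be a proper $CAT(0)$ space with boundary at infinity $\partial M$ (asymptoty classes of geodesic rays), let $G$ be a group acting on $M$ by isometries, and let $A$ be a finitely generated $G$-module. Let $\epsilon:F\twoheadrightarrow A$ be any presentation by a free $G$-module $F=F_X$ on a finite set $X$. Choose any non-empty finite sets $h(x)\subseteq M$ ($x\in X$); put $h(gx)=g\,h(x)$ for $g\in G$, $x\in X$, and, for $c\in F$, let $h(c)$ be the union of the sets $h(y)$ over those elements $y$ of the $\mathbb Z$-basis $GX$ that occur with non-zero coefficient in $c$ (a control map). For a ray $\gamma$ let $\beta_\gamma(p)=\lim_{t\to\infty}\bigl(t-d(p,\gamma(t))\bigr)$ and $v_\gamma(c)=\min\beta_\gamma(h(c))\in\mathbb R\cup\{\infty\}$, with $v_\gamma(0)=\infty$. For an additive map $\varphi:F\to F$ and $e=\gamma(\infty)\in\partial M$ put $$\mathrm{gsh}_e(\varphi)=\inf\{v_\gamma(\varphi(c))-v_\gamma(c)\mid 0\ne c\in F\},\qquad \Sigma(\varphi)=\{e\in\partial M\mid \mathrm{gsh}_e(\varphi)>0\}$$ (this does not depend on the choice of $\gamma$ in the class $e$), and let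 $\|\varphi\|\in[0,\infty]$ be the infimum of all $r\ge 0$ such that $h(\varphi(c))$ lies in the $r$-neighbourhood of $h(c)$ for all $c\in F$. An additive map $\varphi:F\to F$ is $G$-finitary if there is a $G$-equivariant map $\Phi$ from $F$ to the set of finite subsets of $F$ with $\varphi(c)\in\Phi(c)$ for all $c$. Define $${}^{\circ}\Sigma(M;A)=\{e\in\partial M\mid \exists\ G\text{-finitary additive } \varphi:F\to F \text{ with } \epsilon\varphi=\epsilon,\ \mathrm{gsh}_e(\varphi)>0\},$$ $${}^{\circ\circ}\Sigma(M;A)=\{e\in\partial M\mid \exists\ \mathbb ZG\text{-linear } \varphi:F\to F \text{ with } \epsilon\varphi=\epsilon,\ \mathrm{gsh}_e(\varphi)>0\}.$$ **Theorem.** The sets ${}^{\circ}\Sigma(M;A)$ and ${}^{\circ\circ}\Sigma(M;A)$ are open subsets of $\partial M$ in the Tits metric topology. Moreover, $\Sigma(\varphi)$ is open in the Tits metric topology for every additive endomorphism $\varphi$ of $F$ with $\|\varphi\|<\infty$. Here the Tits metric topology may be taken to be the topology of the angular metric $\angle(e,e')$ (the supremum over $p\in M$ of the Alexandrov angle at $p$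 between the rays from $p$ to $e$ and $e'$) or the topology of the associated length metric on $\partial M$; both statements hold. -/

import Mathlib

open Set Filter Topology
open scoped NNReal ENNReal

noncomputable section

namespace LimitSets

/-! ### Geodesic spaces of non-positive curvature -/

/-- `c`, restricted to `[0, d(x,y)]`, is a geodesic from `x` to `y`. -/
def IsGeodesic {M : Type*} [MetricSpace M] (c : ℝ → M) (x y : M) : Prop :=
  c 0 = x ∧ c (dist x y) = y ∧
    ∀ s ∈ Icc 0 (dist x y), ∀ t ∈ Icc 0 (dist x y), dist (c s) (c t) = |s - t|

/-- `M` is a `CAT(0)` space: any two points are joined by a geodesic, and points on two sides of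
a geodesic triangle are at most as far apart as the comparison points in a Euclidean comparison
triangle `p' q' r'`. Any two sides of a triangle share a vertex, here called `p`. -/
structure IsCAT0 (M : Type*) [MetricSpace M] : Prop where
  exists_geodesic : ∀ x y : M, ∃ c : ℝ → M, IsGeodesic c x y
  comparison : ∀ (p q r : M) (c₁ c₂ : ℝ → M), IsGeodesic c₁ p q → IsGeodesic c₂ p r →
    ∀ s ∈ Icc 0 (dist p q), ∀ t ∈ Icc 0 (dist p r),
    ∀ p' q' r' x' y' : EuclideanSpace ℝ (Fin 2),
      dist p' q' = dist p q → dist q' r' = dist q r → dist p' r' = dist p r →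
      x' ∈ segment ℝ p' q' → dist p' x' = s →
      y' ∈ segment ℝ p' r' → dist p' y' = t →
      dist (c₁ s) (c₂ t) ≤ dist x' y'

/-! ### The boundary at infinity -/

/-- Geodesic rays `[0,∞) → M`, parametrized by arc length. -/
structure Ray (M : Type*) [MetricSpace M] where
  toFun : ℝ≥0 → M
  isometry : Isometry toFun

instance {M : Type*} [MetricSpace M] : CoeFun (Ray M) (fun _ => ℝ≥0 → M) := ⟨Ray.toFun⟩

/-- Two rays are asymptotic when they stay at bounded distance from one another. -/
instance asymptotic (M : Type*) [MetricSpace M] : Setoid (Ray M) where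
  r γ γ' := ∃ K : ℝ, ∀ t, dist (γ t) (γ' t) ≤ K
  iseqv :=
    { refl := fun γ => ⟨0, fun t => by simp⟩
      symm := fun ⟨K, hK⟩ => ⟨K, fun t => by rw [dist_comm]; exact hK t⟩
      trans := fun ⟨K, hK⟩ ⟨L, hL⟩ =>
        ⟨K + L, fun t => (dist_triangle _ _ _).trans (add_le_add (hK t) (hL t))⟩ }

/-- The boundary at infinity `∂M`: asymptoty classes of geodesic rays. -/
def Boundary (M : Type*) [MetricSpace M] : Type _ := Quotient (asymptotic M)

/-- The end point `γ(∞)` of a ray. -/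
def Ray.endpoint {M : Type*} [MetricSpace M] (γ : Ray M) : Boundary M :=
  Quotient.mk (asymptotic M) γ

/-- A ray representing a boundary point. The shifts defined below do not depend on its choice. -/
def Boundary.ray {M : Type*} [MetricSpace M] (e : Boundary M) : Ray M := Quotient.out e

/-- The Busemann function `β_γ(p) = lim_{t → ∞} (t - d(p, γ(t)))`, normalized to be `0` at `γ(0)`
and to tend to `+∞` along `γ`. (The limit exists: the expression is non-decreasing in `t` and
bounded by `d(p, γ(0))`.) -/
def busemann {M : Type*} [MetricSpace M] (γ : Ray M) (p : M) : ℝ :=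
  limUnder atTop (fun t : ℝ≥0 => (t : ℝ) - dist p (γ t))

/-! ### The angular metric and the Tits metric on the boundary -/

/-- The angle at the vertex corresponding to `p` in a Euclidean comparison triangle for
`p, x, y` (where `x ≠ p ≠ y`). -/
def comparisonAngle {M : Type*} [MetricSpace M] (p x y : M) : ℝ :=
  Real.arccos ((dist p x ^ 2 + dist p y ^ 2 - dist x y ^ 2) / (2 * dist p x * dist p y))

/-- The (Alexandrov) angle between two rays issuing from the same point. -/
def rayAngle {M : Type*} [MetricSpace M] (γ γ' : Ray M) : ℝ :=
  limsup (fun st : ℝ≥0 × ℝ≥0 => comparisonAngle (γ 0) (γ st.1) (γ' st.2))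
    (𝓝[>] (0 : ℝ≥0) ×ˢ 𝓝[>] (0 : ℝ≥0))

/-- The angular distance `∠(e, e')`: the supremum, over all points `p` of `M`, of the angle at `p`
between the rays from `p` to `e` and `e'`. All these angles lie in `[0, π]`. -/
def angle {M : Type*} [MetricSpace M] (e e' : Boundary M) : ℝ :=
  sSup {θ : ℝ | ∃ γ γ' : Ray M, γ 0 = γ' 0 ∧ γ.endpoint = e ∧ γ'.endpoint = e' ∧
    θ = rayAngle γ γ'}

/-- The topology of a metric `d` (with values in `[0,∞]`): a set is open when it contains a
`d`-ball of positive radius around each of its points. -/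
@[reducible] def metricTopology {B : Type*} (d : B → B → ℝ≥0∞) : TopologicalSpace B where
  IsOpen S := ∀ e ∈ S, ∃ r : ℝ≥0∞, 0 < r ∧ ∀ e', d e e' < r → e' ∈ S
  isOpen_univ := fun _ _ => ⟨1, one_pos, fun _ _ => mem_univ _⟩
  isOpen_inter := fun S T hS hT e he => by
    obtain ⟨r, hr, hrS⟩ := hS e he.1
    obtain ⟨s, hs, hsT⟩ := hT e he.2
    exact ⟨min r s, lt_min hr hs, fun e' h =>
      ⟨hrS e' (h.trans_le (min_le_left _ _)), hsT e' (h.trans_le (min_le_right _ _))⟩⟩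
  isOpen_sUnion := fun 𝒮 h𝒮 e ⟨S, hS, he⟩ => by
    obtain ⟨r, hr, hrS⟩ := h𝒮 S hS e he
    exact ⟨r, hr, fun e' h => ⟨S, hS, hrS e' h⟩⟩

/-- The topology of the angular metric on `∂M`. -/
@[reducible] def angularTopology (M : Type*) [MetricSpace M] : TopologicalSpace (Boundary M) :=
  metricTopology (fun e e' => ENNReal.ofReal (angle e e'))

/-- The length, in the angular metric, of a curve `[0,1] → ∂M`. -/
def angularLength {M : Type*} [MetricSpace M] (c : unitInterval → Boundary M) : ℝ≥0∞ :=
  ⨆ (n : ℕ) (u : ℕ → unitInterval) (_ : Monotone u),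
    ∑ i ∈ Finset.range n, ENNReal.ofReal (angle (c (u i)) (c (u (i + 1))))

/-- The length metric on `∂M` associated with the angular metric; it is `∞` for points that are
not joined by a rectifiable curve. -/
def titsDist {M : Type*} [MetricSpace M] (e e' : Boundary M) : ℝ≥0∞ :=
  ⨅ (c : unitInterval → Boundary M) (_ : Continuous[inferInstance, angularTopology M] c)
    (_ : c 0 = e) (_ : c 1 = e'), angularLength c

/-- The topology on `∂M` of the Tits metric, taken as the length metric of the angular metric. -/
@[reducible] def titsTopology (M : Type*) [MetricSpace M] : TopologicalSpace (Boundary M) :=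
  metricTopology titsDist

/-! ### `G`-modules, finitary homomorphisms, control maps -/

/-- The action of a group element on a `G`-module (a module over the group ring `ℤG`). -/
def act {G : Type*} [Group G] {A : Type*} [AddCommGroup A] [Module (MonoidAlgebra ℤ G) A]
    (g : G) (a : A) : A :=
  MonoidAlgebra.of ℤ G g • a

/-- An additive map `φ` is `G`-finitary when there is a `G`-map `Φ` from `A` to the finite subsets
of `B` with `φ a ∈ Φ a` for all `a`. -/
def IsFinitary (G : Type*) [Group G] {A B : Type*} [AddCommGroup A] [AddCommGroup B]
    [Module (MonoidAlgebra ℤ G) A] [Module (MonoidAlgebra ℤ G) B] (φ : A →+ B) : Prop :=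
  ∃ Φ : A → Set B, (∀ a, (Φ a).Finite) ∧ (∀ (g : G) (a : A), Φ (act g a) = act g '' Φ a) ∧
    ∀ a, φ a ∈ Φ a

/-- The free `G`-module `F_X` with basis `X`. Its `ℤ`-basis is `Y = GX`. -/
abbrev FreeMod (G : Type*) [Group G] (X : Type*) : Type _ := X →₀ MonoidAlgebra ℤ G

/-- The support of `c ∈ F_X`: the pair `(g, x)` stands for the element `gx` of `Y = GX`. -/
def supp {G : Type*} [Group G] {X : Type*} (c : FreeMod G X) : Set (G × X) :=
  {y | (c y.2).coeff y.1 ≠ 0}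

/-- The data of a (centerless) control map: a non-empty finite subset `h x` of `M` for every
basis element `x`. -/
structure ControlMap (X M : Type*) where
  toFun : X → Finset M
  nonempty : ∀ x, (toFun x).Nonempty

section Control

variable {G : Type*} [Group G] {X M : Type*} [MetricSpace M] [MulAction G M]

/-- The control map `h` on `F_X`: `h(gx) = g h(x)` on `Y = GX`, and `h(c)` is the union of the
`h(y)` with `y` in the support of `c`. -/
def ControlMap.eval (h : ControlMap X M) (c : FreeMod G X) : Set M :=
  ⋃ y ∈ supp c, (fun p : M => y.1 • p) '' (h.toFun y.2 : Set M)

/-- The valuation `v_γ(c) = min β_γ(h(c))`, equal to `∞` at `c = 0`. -/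
def valuation (h : ControlMap X M) (γ : Ray M) (c : FreeMod G X) : EReal :=
  ⨅ p ∈ h.eval c, (busemann γ p : EReal)

/-- The norm `‖φ‖ ∈ [0,∞]`: the infimum of all `r ≥ 0` such that, for all `c`, the set `h(φ(c))`
lies in the `r`-neighbourhood of `h(c)`. -/
def controlNorm (h : ControlMap X M) (φ : FreeMod G X →+ FreeMod G X) : ℝ≥0∞ :=
  ⨅ (r : ℝ≥0) (_ : ∀ c, ∀ p ∈ h.eval (φ c), ∃ q ∈ h.eval c, dist p q ≤ r), (r : ℝ≥0∞)

/-- The guaranteed shift of `φ` towards `e`: the infimum of `v_e(φ(c)) - v_e(c)`. The element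
`c = 0`, for which the difference is `∞ - ∞`, is left out. -/
def gsh (h : ControlMap X M) (φ : FreeMod G X →+ FreeMod G X) (e : Boundary M) : EReal :=
  ⨅ (c : FreeMod G X) (_ : c ≠ 0), (valuation h e.ray (φ c) - valuation h e.ray c)

/-- `Σ(φ)`: the set of boundary points towards which `φ` pushes the free module. -/
def pushSet (h : ControlMap X M) (φ : FreeMod G X →+ FreeMod G X) : Set (Boundary M) :=
  {e | 0 < gsh h φ e}

variable {A : Type*} [AddCommGroup A] [Module (MonoidAlgebra ℤ G) A]

/-- The `G`-finitary dynamical limit set `°Σ(M; A)`, computed from the free presentation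
`ε : F_X → A` and the control map `h`. -/
def finitarySigma (ε : FreeMod G X →ₗ[MonoidAlgebra ℤ G] A) (h : ControlMap X M) :
    Set (Boundary M) :=
  {e | ∃ φ : FreeMod G X →+ FreeMod G X,
    IsFinitary G φ ∧ (∀ c, ε (φ c) = ε c) ∧ 0 < gsh h φ e}

/-- The `G`-equivariant dynamical limit set `°°Σ(M; A)`, computed from the free presentation
`ε : F_X → A` and the control map `h`. -/
def equivariantSigma (ε : FreeMod G X →ₗ[MonoidAlgebra ℤ G] A) (h : ControlMap X M) :
    Set (Boundary M) :=
  {e | ∃ φ : FreeMod G X →ₗ[MonoidAlgebra ℤ G] FreeMod G X,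
    (∀ c, ε (φ c) = ε c) ∧ 0 < gsh h φ.toAddMonoidHom e}

end Control

end LimitSets

end

/-!
The idea is that two Busemann functions belonging to boundary points at a small angle have nearly
the same increments over bounded distances, uniformly over the whole space, and that the condition
`gsh_e(φ) > 0` only involves increments over bounded distances.

*Reduction to bounded distances.* As `φ` is additive, `supp (φ c)` is covered by the sets
`supp (φ y)` with `y` in the support of `c`, so `gsh_e(φ) ≥ δ` can be tested on the `ℤ`-basis `GX`:
each point of `h(φ y)` has to be `δ` further towards `e` than some point of `h(y)`
(`le_gsh_iff`, `forall_eval_of_basisElt`). The sets `h(y)` have bounded diameter and `h(φ y)` lies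
within `‖φ‖` of `h(y)`, so only pairs of points at bounded distance are compared. For the two limit
sets, `‖φ‖ < ∞` is automatic (`IsFinitary.controlNorm_lt_top`).

*Comparison of Busemann functions.* For a ray `γ` and a point `a`, a limit `σ` of geodesics from `a`
to points far out on `γ` is a ray asymptotic to `γ`, and Stewart's inequality passes to the limit:
`d(b, σ t)² ≤ d(a, b)² + t² - 2t (β_γ b - β_γ a)` (`IsCAT0.exists_isParallel`). Therefore
`β_γ b - β_γ a` equals `t - d(b, σ t)` up to an error of `d(a, b)² / 2t`. If `σ'` is the ray obtained
in the same way from `γ'`, it remains to see that `d(σ t, σ' t)` is small compared with `t` when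
`∠(γ(∞), γ'(∞)) < θ`. At every point `σ x` the rays to the two boundary points enclose an angle less
than `θ`, so that they diverge at a rate of at most `θ` close to `σ x`. Hence `β_γ'` grows along `σ`
at rate at least `1 - θ` (`IsCAT0.busemann_growth`), and the limit of Stewart's inequality for `σ'`,
applied at `σ t`, gives `d(σ t, σ' t)² ≤ 2 θ t²`. For a given bound on `d(a, b)`, take first `t`
large and then `θ` small (`IsCAT0.exists_angle_bound`).

Finally, the length metric is at least the angular metric, so that sets open for the latter are open
for the former.
-/

noncomputable section

namespace LimitSets

section Geometry

variable {M : Type*} [MetricSpace M]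

/-! ### Stewart's inequality in a `CAT(0)` space -/

/-- Stewart's theorem, as an inequality: the distance from `r` to a point of a geodesic from `p`
to `q` is at most what it is in a Euclidean triangle with the same side lengths. -/
theorem IsCAT0.stewart (hM : IsCAT0 M) {p q : M} (r : M) {c : ℝ → M} (hc : IsGeodesic c p q)
    {t : ℝ} (ht : t ∈ Icc 0 (dist p q)) :
    dist p q * dist r (c t) ^ 2 ≤ (dist p q - t) * dist p r ^ 2 + t * dist r q ^ 2
      - t * (dist p q - t) * dist p q := by
  obtain ⟨c₂, hc₂⟩ := hM.exists_geodesic p r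
  rcases (dist_nonneg : 0 ≤ dist p q).eq_or_lt with h0 | hL
  · rw [← h0] at ht
    obtain rfl : t = 0 := le_antisymm ht.2 ht.1
    rw [← h0]; simp
  have h1 := dist_triangle p r q
  have h2 := dist_triangle p q r
  have h3 := dist_triangle q p r
  rw [dist_comm q p] at h3
  rw [dist_comm q r] at h2 h3
  have hb : 0 ≤ dist p r := dist_nonneg
  have hd : 0 ≤ dist r q := dist_nonneg
  have hcmp := hM.comparison p q r c c₂ hc hc₂ t ht (dist p r) ⟨hb, le_rfl⟩
  rw [hc₂.2.1] at hcmp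
  rw [dist_comm q r, dist_comm (c t) r] at hcmp
  generalize dist p q = L at *
  generalize dist p r = b at *
  generalize dist r q = d at *
  -- The comparison triangle has vertices `(0, 0)`, `(L, 0)` and `(x, √(b² - x²))`.
  set x : ℝ := (b ^ 2 + L ^ 2 - d ^ 2) / (2 * L) with hx
  have hxL : 2 * L * x = b ^ 2 + L ^ 2 - d ^ 2 := by rw [hx]; field_simp
  have hxb : x ^ 2 ≤ b ^ 2 := by
    apply sq_le_sq'
    · rw [hx, le_div_iff₀ (by positivity)]; nlinarith
    · rw [hx, div_le_iff₀ (by positivity)]; nlinarith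
  have hs : √(b ^ 2 - x ^ 2) ^ 2 = b ^ 2 - x ^ 2 := Real.sq_sqrt (by linarith)
  have key := hcmp !₂[0, 0] !₂[L, 0] !₂[x, √(b ^ 2 - x ^ 2)] !₂[t, 0] !₂[x, √(b ^ 2 - x ^ 2)]
    (by simp [EuclideanSpace.dist_eq, Real.dist_eq, Real.sqrt_sq hL.le])
    (by
      have h : (L - x) ^ 2 + (b ^ 2 - x ^ 2) = d ^ 2 := by linarith
      simp [EuclideanSpace.dist_eq, Real.dist_eq, hs, h, Real.sqrt_sq hd])
    (by
      simp [EuclideanSpace.dist_eq, Real.dist_eq, hs, Real.sqrt_sq hb])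
    (by
      refine ⟨1 - t / L, t / L, ?_, ?_, by ring, ?_⟩
      · rw [sub_nonneg, div_le_one hL]; exact ht.2
      · exact div_nonneg ht.1 hL.le
      · ext i; fin_cases i <;> simp [hL.ne'])
    (by simp [EuclideanSpace.dist_eq, Real.dist_eq, Real.sqrt_sq ht.1])
    (right_mem_segment ℝ _ _)
    (by
      simp [EuclideanSpace.dist_eq, Real.dist_eq, hs, Real.sqrt_sq hb])
  have hsq : dist r (c t) ^ 2 ≤ t ^ 2 - 2 * t * x + b ^ 2 := by
    refine (pow_le_pow_left₀ dist_nonneg key 2).trans (le_of_eq ?_)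
    rw [EuclideanSpace.dist_eq, Real.sq_sqrt (by positivity)]
    simp [Real.dist_eq, hs]
    ring
  calc L * dist r (c t) ^ 2 ≤ L * (t ^ 2 - 2 * t * x + b ^ 2) := by gcongr
    _ = L * t ^ 2 - t * (2 * L * x) + L * b ^ 2 := by ring
    _ = _ := by rw [hxL]; ring

/-! ### Busemann functions -/

theorem Ray.dist_eq (γ : Ray M) (s t : ℝ≥0) : dist (γ s) (γ t) = |(s : ℝ) - t| := by
  rw [γ.isometry.dist_eq, NNReal.dist_eq]

theorem Ray.dist_add (γ : Ray M) (s t : ℝ≥0) : dist (γ s) (γ (s + t)) = t := by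
  simp [γ.dist_eq]

theorem tendsto_busemann (γ : Ray M) (p : M) :
    Tendsto (fun t : ℝ≥0 => (t : ℝ) - dist p (γ t)) atTop (𝓝 (busemann γ p)) := by
  have hmono : Monotone (fun t : ℝ≥0 => (t : ℝ) - dist p (γ t)) := by
    intro s t hst
    have h := dist_triangle p (γ s) (γ t)
    rw [γ.dist_eq, abs_sub_comm, abs_of_nonneg (sub_nonneg.2 (NNReal.coe_le_coe.2 hst))] at h
    simp only
    linarith
  have hbdd : BddAbove (range fun t : ℝ≥0 => (t : ℝ) - dist p (γ t)) := by
    refine ⟨dist (γ 0) p, ?_⟩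
    rintro _ ⟨t, rfl⟩
    have h := dist_triangle (γ 0) p (γ t)
    rw [γ.dist_eq] at h
    simp only [NNReal.coe_zero, zero_sub, abs_neg, NNReal.abs_eq] at h
    simp only
    linarith
  have h := tendsto_atTop_ciSup hmono hbdd
  rw [busemann, h.limUnder_eq]
  exact h

theorem tendsto_busemann_nat (γ : Ray M) (p : M) :
    Tendsto (fun n : ℕ => (n : ℝ) - dist p (γ n)) atTop (𝓝 (busemann γ p)) := by
  have h : Tendsto (fun n : ℕ => (n : ℝ≥0)) atTop atTop := tendsto_natCast_atTop_atTop
  exact (tendsto_busemann γ p).comp h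

theorem busemann_sub_le_dist (γ : Ray M) (p q : M) :
    busemann γ p - busemann γ q ≤ dist p q := by
  refine le_of_tendsto ((tendsto_busemann γ p).sub (tendsto_busemann γ q))
    (Eventually.of_forall fun t => ?_)
  have h := dist_triangle q p (γ t)
  rw [dist_comm q p] at h
  linarith

theorem continuous_busemann (γ : Ray M) : Continuous (busemann γ) :=
  (LipschitzWith.of_le_add fun p q => by
    have := busemann_sub_le_dist γ p q; linarith).continuous

theorem busemann_apply_self (γ : Ray M) (t : ℝ≥0) : busemann γ (γ t) = t := by
  refine tendsto_nhds_unique (tendsto_busemann γ (γ t)) (tendsto_const_nhds.congr' ?_)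
  filter_upwards [eventually_ge_atTop t] with s hs
  rw [γ.dist_eq, abs_sub_comm, abs_of_nonneg (sub_nonneg.2 (NNReal.coe_le_coe.2 hs))]
  ring

/-! ### Rays towards a given boundary point -/

/-- The ray `t ↦ γ (s + t)`. -/
def Ray.shift (γ : Ray M) (s : ℝ≥0) : Ray M where
  toFun t := γ (s + t)
  isometry := Isometry.of_dist_eq fun t u => by rw [γ.isometry.dist_eq]; simp [NNReal.dist_eq]

theorem Ray.endpoint_shift (γ : Ray M) (s : ℝ≥0) : (γ.shift s).endpoint = γ.endpoint := by
  refine Quotient.sound ⟨s, fun t => le_of_eq ?_⟩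
  change dist (γ (s + t)) (γ t) = s
  rw [dist_comm, add_comm, γ.dist_add]

/-- `σ` runs towards the end point of `γ`, in the form in which this is used below: besides being
asymptotic to `γ`, it is a gradient line of the Busemann function of `γ`, and it satisfies the limit
of Stewart's inequality for geodesics from `σ 0` to points far out on `γ`. -/
structure IsParallel (γ σ : Ray M) : Prop where
  endpoint_eq : σ.endpoint = γ.endpoint
  add_le_busemann : ∀ t : ℝ≥0, busemann γ (σ 0) + t ≤ busemann γ (σ t)
  sq_dist_le : ∀ (b : M) (t : ℝ≥0), dist b (σ t) ^ 2 ≤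
    dist (σ 0) b ^ 2 + t ^ 2 - 2 * t * (busemann γ b - busemann γ (σ 0))

theorem tendsto_dist_nat_atTop (γ : Ray M) (a : M) :
    Tendsto (fun n : ℕ => dist a (γ n)) atTop atTop := by
  refine tendsto_atTop_mono (fun n => ?_)
    (tendsto_atTop_add_const_right _ (-dist a (γ 0)) (tendsto_natCast_atTop_atTop (R := ℝ)))
  have h := dist_triangle_left (γ 0) (γ n) a
  rw [γ.dist_eq] at h
  simp at h
  linarith

/-- The limit, as `n → ∞`, of Stewart's inequality for geodesics from `a` to `γ n`. -/
theorem IsCAT0.sq_dist_le_of_tendsto (hM : IsCAT0 M) (γ : Ray M) {a x : M} {c : ℕ → ℝ → M}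
    (hc : ∀ n : ℕ, IsGeodesic (c n) a (γ n)) {l : Filter ℕ} [l.NeBot] (hl : l ≤ atTop) (t : ℝ≥0)
    (hx : Tendsto (fun n => c n t) l (𝓝 x)) (b : M) :
    dist b x ^ 2 ≤ dist a b ^ 2 + t ^ 2 - 2 * t * (busemann γ b - busemann γ a) := by
  have hL := tendsto_dist_nat_atTop γ a
  have hv : Tendsto (fun n : ℕ => dist b (γ n) - dist a (γ n)) l
      (𝓝 (busemann γ a - busemann γ b)) :=
    (((tendsto_busemann_nat γ a).sub (tendsto_busemann_nat γ b)).mono_left hl).congr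
      fun n => by ring
  have hi : Tendsto (fun n : ℕ => (dist a (γ n))⁻¹) l (𝓝 0) :=
    (tendsto_inv_atTop_zero.comp hL).mono_left hl
  have hlim : Tendsto (fun n : ℕ => dist a b ^ 2 - t * dist a b ^ 2 * (dist a (γ n))⁻¹
      + t * ((dist b (γ n) - dist a (γ n)) ^ 2 * (dist a (γ n))⁻¹
        + 2 * (dist b (γ n) - dist a (γ n))) + t ^ 2) l
      (𝓝 (dist a b ^ 2 - t * dist a b ^ 2 * 0
      + t * ((busemann γ a - busemann γ b) ^ 2 * 0
        + 2 * (busemann γ a - busemann γ b)) + t ^ 2)) :=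
    ((tendsto_const_nhds.sub (hi.const_mul _)).add
      ((((hv.pow 2).mul hi).add (hv.const_mul 2)).const_mul _)).add_const _
  have hfin := le_of_tendsto_of_tendsto (((tendsto_const_nhds (x := b)).dist hx).pow 2) hlim ?_
  · refine hfin.trans (le_of_eq ?_)
    ring
  · filter_upwards [hl ((tendsto_atTop.1 hL) t), hl ((tendsto_atTop.1 hL) 1)] with n hn h1
    have hpos : 0 < dist a (γ n) := by linarith
    have hst := hM.stewart b (hc n) (t := (t : ℝ)) ⟨t.2, hn⟩
    rw [mul_comm, ← le_div_iff₀ hpos] at hst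
    refine hst.trans (le_of_eq ?_)
    field_simp
    ring

theorem Ray.isGeodesic (γ : Ray M) (t : ℝ≥0) :
    IsGeodesic (fun s : ℝ => γ s.toNNReal) (γ 0) (γ t) := by
  refine ⟨by simp, by simp [γ.dist_eq], fun s hs u hu => ?_⟩
  rw [γ.dist_eq, Real.coe_toNNReal _ hs.1, Real.coe_toNNReal _ hu.1]

/-- In a proper `CAT(0)` space there is a ray from any point to any boundary point. -/
theorem IsCAT0.exists_isParallel [ProperSpace M] (hM : IsCAT0 M) (γ : Ray M) (a : M) :
    ∃ σ : Ray M, σ 0 = a ∧ IsParallel γ σ := by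
  -- `σ` is the pointwise limit, along an ultrafilter, of geodesics `c n` from `a` to `γ n`.
  choose c hc using fun n : ℕ => hM.exists_geodesic a (γ n)
  have hL := tendsto_dist_nat_atTop γ a
  set U : Ultrafilter ℕ := hyperfilter ℕ
  have hle : (U : Filter ℕ) ≤ atTop := Nat.hyperfilter_le_atTop
  have hev : ∀ t : ℝ≥0, ∀ᶠ n : ℕ in (U : Filter ℕ), (t : ℝ) ∈ Icc 0 (dist a (γ n)) := fun t =>
    hle (((tendsto_atTop.1 hL) t).mono fun n hn => ⟨t.2, hn⟩)
  have hex : ∀ t : ℝ≥0, ∃ x : M, Tendsto (fun n => c n t) U (𝓝 x) := by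
    intro t
    have hmem : Metric.closedBall a t ∈ U.map (fun n => c n t) := by
      refine (hev t).mono fun n hn => ?_
      have h := (hc n).2.2 t hn 0 ⟨le_rfl, dist_nonneg⟩
      rw [(hc n).1] at h
      simp [h]
    obtain ⟨x, -, hx⟩ := (isCompact_closedBall a (t : ℝ)).ultrafilter_le_nhds' _ hmem
    exact ⟨x, hx⟩
  choose σ hσ using hex
  have hσ0 : σ 0 = a := by
    refine tendsto_nhds_unique (hσ 0) (tendsto_const_nhds.congr fun n => ?_)
    simpa using (hc n).1.symm
  have hiso : Isometry σ := by
    refine Isometry.of_dist_eq fun s t => ?_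
    refine tendsto_nhds_unique ((hσ s).dist (hσ t)) (tendsto_const_nhds.congr' ?_)
    filter_upwards [hev s, hev t] with n hs ht
    rw [(hc n).2.2 _ hs _ ht, NNReal.dist_eq]
  have hbus : ∀ t : ℝ≥0, busemann γ a + t ≤ busemann γ (σ t) := by
    intro t
    have h1 : Tendsto (fun n : ℕ => (n : ℝ) - dist (c n t) (γ n)) U (𝓝 (busemann γ a + t)) := by
      refine (((tendsto_busemann_nat γ a).mono_left hle).add_const (t : ℝ)).congr' ?_
      filter_upwards [hev t] with n hn
      have h := (hc n).2.2 t hn _ ⟨dist_nonneg, le_rfl⟩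
      rw [(hc n).2.1, abs_sub_comm, abs_of_nonneg (sub_nonneg.2 hn.2)] at h
      rw [h]; ring
    have h2 : Tendsto (fun n : ℕ => (n : ℝ) - dist (σ t) (γ n) + dist (c n t) (σ t)) U
        (𝓝 (busemann γ (σ t) + 0)) := by
      refine ((tendsto_busemann_nat γ (σ t)).mono_left hle).add ?_
      simpa using (hσ t).dist (tendsto_const_nhds (x := σ t))
    rw [add_zero] at h2
    refine le_of_tendsto_of_tendsto' h1 h2 fun n => ?_
    have := dist_triangle_left (σ t) (γ n) (c n t)
    linarith
  have hsq : ∀ (b : M) (t : ℝ≥0), dist b (σ t) ^ 2 ≤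
      dist a b ^ 2 + t ^ 2 - 2 * t * (busemann γ b - busemann γ a) := fun b t =>
    hM.sq_dist_le_of_tendsto γ hc hle t (hσ t) b
  refine ⟨⟨σ, hiso⟩, hσ0, ?_, ?_, ?_⟩
  · -- The squared distance estimates for `γ` and for `σ` add up to `d(γ t, σ t) ≤ d(γ 0, a)`.
    refine Quotient.sound ⟨dist (γ 0) a, fun t => ?_⟩
    have h1 := hsq (γ t) t
    have h2 := hM.sq_dist_le_of_tendsto γ (fun n : ℕ => γ.isGeodesic n) (l := atTop) le_rfl t
      (x := γ t) (by simp) a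
    rw [busemann_apply_self] at h1
    have h0 : busemann γ (γ 0) = 0 := by simpa using busemann_apply_self γ 0
    rw [h0] at h2
    rw [dist_comm]
    change dist (γ t) (σ t) ≤ _
    refine abs_le_of_sq_le_sq' (a := dist (γ t) (σ t)) ?_ dist_nonneg |>.2
    linarith
  · rw [show (Ray.mk σ hiso) 0 = a from hσ0]; exact hbus
  · rw [show (Ray.mk σ hiso) 0 = a from hσ0]; exact hsq

/-! ### Small angles -/

theorem comparisonAngle_mem (p x y : M) : comparisonAngle p x y ∈ Icc 0 Real.pi :=
  ⟨Real.arccos_nonneg _, Real.arccos_le_pi _⟩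

theorem rayAngle_le_pi (γ γ' : Ray M) : rayAngle γ γ' ≤ Real.pi :=
  limsup_le_of_le
    (isCoboundedUnder_le_of_le _ (x := 0) fun _ => (comparisonAngle_mem _ _ _).1)
    (Eventually.of_forall fun _ => (comparisonAngle_mem _ _ _).2)

theorem rayAngle_le_angle {σ σ' : Ray M} (h0 : σ 0 = σ' 0) :
    rayAngle σ σ' ≤ angle σ.endpoint σ'.endpoint := by
  refine le_csSup ⟨Real.pi, ?_⟩ ⟨σ, σ', h0, rfl, rfl, rfl⟩
  rintro _ ⟨γ, γ', -, -, -, rfl⟩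
  exact rayAngle_le_pi γ γ'

theorem eventually_dist_le_of_rayAngle_lt {σ σ' : Ray M} (h0 : σ 0 = σ' 0) {θ : ℝ}
    (hθ0 : 0 ≤ θ) (hθ : θ ≤ Real.pi) (h : rayAngle σ σ' < θ) :
    ∀ᶠ s in 𝓝[>] (0 : ℝ≥0), dist (σ s) (σ' s) ≤ θ * s := by
  have hev := eventually_lt_of_limsup_lt h
    (isBoundedUnder_of ⟨Real.pi, fun _ => (comparisonAngle_mem _ _ _).2⟩)
  have hdiag : Tendsto (fun s : ℝ≥0 => (s, s)) (𝓝[>] (0 : ℝ≥0))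
      (𝓝[>] (0 : ℝ≥0) ×ˢ 𝓝[>] (0 : ℝ≥0)) := tendsto_id.prodMk tendsto_id
  filter_upwards [hdiag.eventually hev, self_mem_nhdsWithin] with s hs hpos
  have hs0 : (0 : ℝ) < s := NNReal.coe_pos.2 hpos
  have hd : ∀ γ : Ray M, dist (γ 0) (γ s) = s := fun γ => by simp [γ.dist_eq]
  rw [comparisonAngle, hd σ, h0, hd σ'] at hs
  have hcos : Real.cos θ < (s ^ 2 + s ^ 2 - dist (σ s) (σ' s) ^ 2) / (2 * s * s) := by
    by_contra! hle
    have := Real.antitone_arccos hle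
    rw [Real.arccos_cos hθ0 hθ] at this
    linarith
  have h2 := Real.one_sub_sq_div_two_le_cos (x := θ)
  have h3 := h2.trans_lt hcos
  rw [lt_div_iff₀ (by positivity)] at h3
  refine abs_le_of_sq_le_sq' (a := dist (σ s) (σ' s)) ?_ (by positivity) |>.2
  nlinarith

/-- Along a ray whose end point is within angular distance `θ` of that of `γ'`, the Busemann
function of `γ'` grows at rate at least `1 - θ`. -/
theorem IsCAT0.busemann_growth [ProperSpace M] (hM : IsCAT0 M) (γ' σ : Ray M) {θ : ℝ}
    (hθ0 : 0 ≤ θ) (hθ : θ ≤ Real.pi) (h : angle σ.endpoint γ'.endpoint < θ) (t : ℝ≥0) :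
    busemann γ' (σ 0) + (1 - θ) * t ≤ busemann γ' (σ t) := by
  -- It suffices to know the growth rate to the right of each point `σ x`. There, the ray from `σ x`
  -- to the end point of `γ'` increases the function at unit speed and stays close to `σ`.
  have hloc : ∀ x : ℝ≥0, ∀ᶠ s in 𝓝[>] (0 : ℝ≥0),
      busemann γ' (σ x) + (1 - θ) * s ≤ busemann γ' (σ (x + s)) := by
    intro x
    obtain ⟨σ', h0, hσ'⟩ := hM.exists_isParallel γ' (σ x)
    have h0' : (σ.shift x) 0 = σ' 0 := by rw [h0]; exact congrArg σ.toFun (add_zero x)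
    have hang : rayAngle (σ.shift x) σ' < θ := by
      refine (rayAngle_le_angle h0').trans_lt ?_
      rwa [σ.endpoint_shift, hσ'.endpoint_eq]
    filter_upwards [eventually_dist_le_of_rayAngle_lt h0' hθ0 hθ hang] with s hs
    have h1 := hσ'.add_le_busemann s
    have h2 := busemann_sub_le_dist γ' (σ' s) (σ (x + s))
    rw [dist_comm] at h2
    have h3 : dist (σ (x + s)) (σ' s) ≤ θ * s := hs
    rw [h0] at h1
    linarith
  set f : ℝ → ℝ := fun x => busemann γ' (σ x.toNNReal) with hf
  have hfc : Continuous f :=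
    (continuous_busemann γ').comp (σ.isometry.continuous.comp continuous_real_toNNReal)
  have hcl : IsClosed {x : ℝ | f 0 + (1 - θ) * x ≤ f x} :=
    isClosed_le (by fun_prop) hfc
  have hsub := (hcl.inter isClosed_Icc).Icc_subset_of_forall_mem_nhdsWithin (a := 0) (b := (t : ℝ))
    (by simp) ?_
  · have := hsub ⟨t.2, le_rfl⟩
    simpa [hf] using this
  · rintro x ⟨hx, hx0, -⟩
    have hmap : Tendsto (fun y : ℝ => (y - x).toNNReal) (𝓝[>] x) (𝓝[>] (0 : ℝ≥0)) := by
      refine tendsto_nhdsWithin_iff.2 ⟨?_, ?_⟩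
      · have hct : Continuous fun y : ℝ => (y - x).toNNReal := by fun_prop
        have := hct.tendsto x
        simp only [sub_self, Real.toNNReal_zero] at this
        exact this.mono_left nhdsWithin_le_nhds
      · filter_upwards [self_mem_nhdsWithin] with y hy
        exact Real.toNNReal_pos.2 (sub_pos.2 hy)
    filter_upwards [hmap.eventually (hloc x.toNNReal), self_mem_nhdsWithin] with y hy hxy
    have hxy' : 0 ≤ y - x := (sub_pos.2 hxy).le
    rw [← Real.toNNReal_add hx0 hxy', Real.coe_toNNReal _ hxy', add_sub_cancel] at hy
    have hx' : f 0 + (1 - θ) * x ≤ f x := hx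
    change f 0 + (1 - θ) * y ≤ f y
    change f x + (1 - θ) * (y - x) ≤ f y at hy
    linarith

/-- The angle controls the rate at which rays from a common point diverge, at all scales and not only
near that point. -/
theorem IsCAT0.dist_le_of_angle_lt [ProperSpace M] (hM : IsCAT0 M) {γ γ' σ σ' : Ray M}
    (hσ : IsParallel γ σ) (hσ' : IsParallel γ' σ') (h0 : σ 0 = σ' 0) {θ : ℝ}
    (hθ0 : 0 ≤ θ) (hθ : θ ≤ Real.pi) (h : angle γ.endpoint γ'.endpoint < θ) (t : ℝ≥0) :
    dist (σ t) (σ' t) ≤ t * √(2 * θ) := by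
  have h1 := hM.busemann_growth γ' σ hθ0 hθ (by rwa [hσ.endpoint_eq]) t
  have h2 := hσ'.sq_dist_le (σ t) t
  rw [← h0, σ.dist_eq] at h2
  simp only [NNReal.coe_zero, zero_sub, abs_neg, NNReal.abs_eq] at h2
  refine abs_le_of_sq_le_sq' (a := dist (σ t) (σ' t)) ?_ (by positivity) |>.2
  rw [mul_pow, Real.sq_sqrt (by positivity)]
  nlinarith [mul_le_mul_of_nonneg_left h1 t.2]

/-- The increment `β_γ(b) - β_γ(a)` is `t - d(b, σ(t))`, up to an error `d(a,b)² / 2t`, for the ray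
`σ` from `a` towards the end point of `γ`; hence increments of Busemann functions at two boundary
points differ by little when the angle between these is small. -/
theorem IsCAT0.busemann_increment_le [ProperSpace M] (hM : IsCAT0 M) (γ γ' : Ray M) {θ : ℝ}
    (hθ0 : 0 ≤ θ) (hθ : θ ≤ Real.pi) (h : angle γ.endpoint γ'.endpoint < θ) (a b : M)
    {t : ℝ≥0} (ht : 0 < t) :
    busemann γ b - busemann γ a ≤
      busemann γ' b - busemann γ' a + (dist a b ^ 2 / (2 * t) + t * √(2 * θ)) := by
  obtain ⟨σ, h0, hσ⟩ := hM.exists_isParallel γ a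
  obtain ⟨σ', h0', hσ'⟩ := hM.exists_isParallel γ' a
  have ht' : (0 : ℝ) < t := NNReal.coe_pos.2 ht
  have hupper : busemann γ b - busemann γ a ≤ t - dist b (σ t) + dist a b ^ 2 / (2 * t) := by
    have h1 := hσ.sq_dist_le b t
    rw [h0] at h1
    have h2 : busemann γ b - busemann γ a - (t - dist b (σ t)) ≤ dist a b ^ 2 / (2 * t) := by
      rw [le_div_iff₀ (by positivity)]
      nlinarith [sq_nonneg (dist b (σ t) - t)]
    linarith
  have hlower : t - dist b (σ' t) ≤ busemann γ' b - busemann γ' a := by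
    have h1 := hσ'.add_le_busemann t
    have h2 := busemann_sub_le_dist γ' (σ' t) b
    rw [dist_comm] at h2
    rw [h0'] at h1
    linarith
  have hd := hM.dist_le_of_angle_lt hσ hσ' (h0.trans h0'.symm) hθ0 hθ h t
  have htri := dist_triangle b (σ t) (σ' t)
  linarith

/-- The angle that makes the increments of two Busemann functions agree up to `η` depends only on `η`
and on a bound for the distance, not on the place in `M`. -/
theorem IsCAT0.exists_angle_bound [ProperSpace M] (hM : IsCAT0 M) (R : ℝ) {η : ℝ} (hη : 0 < η) :
    ∃ θ > 0, ∀ γ γ' : Ray M, angle γ.endpoint γ'.endpoint < θ → ∀ a b : M, dist a b ≤ R →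
      busemann γ b - busemann γ a ≤ busemann γ' b - busemann γ' a + η := by
  set t : ℝ≥0 := ⟨R ^ 2 / η + 1, by positivity⟩
  have htR : (t : ℝ) = R ^ 2 / η + 1 := rfl
  have ht0 : (0 : ℝ) < t := by rw [htR]; positivity
  refine ⟨min Real.pi ((η / (2 * t)) ^ 2 / 2), lt_min Real.pi_pos (by positivity), ?_⟩
  intro γ γ' h a b hab
  have hmin : 0 ≤ min Real.pi ((η / (2 * t)) ^ 2 / 2) := le_min Real.pi_pos.le (by positivity)
  refine (hM.busemann_increment_le γ γ' hmin (min_le_left _ _) h a b (NNReal.coe_pos.1 ht0)).trans ?_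
  have h1 : dist a b ^ 2 / (2 * t) ≤ η / 2 := by
    have : dist a b ^ 2 ≤ R ^ 2 := pow_le_pow_left₀ dist_nonneg hab 2
    rw [div_le_iff₀ (by positivity), htR]
    field_simp
    linarith
  have h2 : t * √(2 * min Real.pi ((η / (2 * t)) ^ 2 / 2)) ≤ η / 2 := by
    have : √(2 * min Real.pi ((η / (2 * t)) ^ 2 / 2)) ≤ η / (2 * t) := by
      refine Real.sqrt_le_iff.2 ⟨by positivity, ?_⟩
      linarith [min_le_right Real.pi ((η / (2 * t)) ^ 2 / 2)]
    calc t * √(2 * min Real.pi ((η / (2 * t)) ^ 2 / 2)) ≤ t * (η / (2 * t)) := by gcongr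
      _ = η / 2 := by field_simp
  linarith

/-! ### The two topologies on the boundary -/

theorem angle_le_titsDist (e e' : Boundary M) : ENNReal.ofReal (angle e e') ≤ titsDist e e' := by
  refine le_iInf fun c => le_iInf fun _ => le_iInf fun h0 => le_iInf fun h1 => ?_
  have hmono : Monotone (fun n : ℕ => if n = 0 then (0 : unitInterval) else 1) := by
    refine monotone_nat_of_le_succ fun n => ?_
    split_ifs <;> simp_all
  refine le_trans ?_ (le_iSup₂_of_le 1 _ (le_iSup_of_le hmono le_rfl))
  simp [h0, h1]

theorem isOpen_titsTopology_of_angularTopology {S : Set (Boundary M)}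
    (hS : IsOpen[angularTopology M] S) : IsOpen[titsTopology M] S := fun e he => by
  obtain ⟨r, hr, h⟩ := hS e he
  exact ⟨r, hr, fun e' h' => h e' ((angle_le_titsDist e e').trans_lt h')⟩

end Geometry

section Algebra

variable {G : Type*} [Group G] {X M : Type*}

/-! ### Supports and the basis `GX` -/

/-- The element `gx` of the `ℤ`-basis `GX` of `F_X`. -/
def basisElt (y : G × X) : FreeMod G X :=
  Finsupp.single y.2 (MonoidAlgebra.single y.1 1)

theorem mem_supp {c : FreeMod G X} {y : G × X} : y ∈ supp c ↔ (c y.2).coeff y.1 ≠ 0 := Iff.rfl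

theorem supp_basisElt (y : G × X) : supp (basisElt y) = {y} := by
  classical
  ext ⟨g, x⟩
  obtain ⟨g', x'⟩ := y
  by_cases hx : x' = x
  · subst hx
    simp [supp, basisElt, Finsupp.single_apply, eq_comm]
  · simp [supp, basisElt, Finsupp.single_apply, hx, Ne.symm hx]

theorem supp_zero : supp (0 : FreeMod G X) = ∅ := by
  simp [supp]

theorem supp_add_subset (a b : FreeMod G X) : supp (a + b) ⊆ supp a ∪ supp b := by
  intro y hy
  by_contra h
  simp only [mem_supp, mem_union, not_or, not_not] at h hy
  exact hy (by simp [h.1, h.2])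

theorem supp_zsmul_subset (n : ℤ) (a : FreeMod G X) : supp (n • a) ⊆ supp a := by
  intro y hy h
  refine hy ?_
  rw [Finsupp.smul_apply, MonoidAlgebra.coeff_smul_apply, h, smul_zero]

theorem supp_sum_subset {ι : Type*} (s : Finset ι) (f : ι → FreeMod G X) :
    supp (∑ i ∈ s, f i) ⊆ ⋃ i ∈ s, supp (f i) := by
  classical
  induction s using Finset.induction_on with
  | empty => simp [supp_zero]
  | insert i s hi ih =>
    rw [Finset.sum_insert hi, Finset.set_biUnion_insert]
    exact (supp_add_subset _ _).trans (union_subset_union_right _ ih)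

theorem finite_supp (c : FreeMod G X) : (supp c).Finite := by
  refine (c.support.finite_toSet.biUnion fun x _ =>
    ((c x).coeff.support.finite_toSet.image fun g => (g, x))).subset ?_
  rintro ⟨g, x⟩ h
  rw [mem_supp] at h
  have hx : c x ≠ 0 := by rintro h0; simp [h0] at h
  simp [hx, h]

theorem supp_nonempty {c : FreeMod G X} (hc : c ≠ 0) : (supp c).Nonempty := by
  obtain ⟨x, hx⟩ := Finsupp.ne_iff.1 hc
  have hx' : (c x).coeff ≠ 0 := by simpa using hx
  obtain ⟨g, hg⟩ := Finsupp.ne_iff.1 hx'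
  exact ⟨(g, x), hg⟩

theorem eq_sum_basisElt (c : FreeMod G X) :
    c = ∑ y ∈ (finite_supp c).toFinset, (c y.2).coeff y.1 • basisElt y := by
  classical
  ext x g
  simp only [Finsupp.finsetSum_apply, MonoidAlgebra.coeff_sum]
  rw [Finset.sum_eq_single (g, x)]
  · simp [basisElt]
  · intro y _ hy
    have : (g, x) ∉ supp (basisElt y) := by rw [supp_basisElt]; exact fun h => hy h.symm
    rw [mem_supp, not_not] at this
    rw [Finsupp.smul_apply, MonoidAlgebra.coeff_smul_apply, this, smul_zero]
  · intro h
    rw [Finite.mem_toFinset, mem_supp, not_not] at h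
    simp [h]

theorem supp_map_subset (φ : FreeMod G X →+ FreeMod G X) (c : FreeMod G X) :
    supp (φ c) ⊆ ⋃ y ∈ supp c, supp (φ (basisElt y)) := by
  conv_lhs => rw [eq_sum_basisElt c, map_sum]
  refine (supp_sum_subset _ _).trans fun z hz => ?_
  simp only [mem_iUnion, Finite.mem_toFinset, map_zsmul] at hz ⊢
  obtain ⟨y, hy, hz⟩ := hz
  exact ⟨y, hy, supp_zsmul_subset _ _ hz⟩

theorem coeff_act (g : G) (c : FreeMod G X) (y : G × X) :
    ((act g c : FreeMod G X) y.2).coeff y.1 = (c y.2).coeff (g⁻¹ * y.1) := by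
  simp [act, MonoidAlgebra.of, MonoidAlgebra.coeff_single_mul_apply]

theorem act_basisElt (g : G) (x : X) : act g (basisElt ((1 : G), x)) = basisElt (g, x) := by
  simp [act, basisElt]

/-! ### Control maps -/

variable [MulAction G M] (h : ControlMap X M)

theorem finite_eval (c : FreeMod G X) : (h.eval c).Finite :=
  (finite_supp c).biUnion fun y _ => (h.toFun y.2).finite_toSet.image _

theorem eval_nonempty {c : FreeMod G X} (hc : c ≠ 0) : (h.eval c).Nonempty := by
  obtain ⟨y, hy⟩ := supp_nonempty hc
  obtain ⟨p, hp⟩ := h.nonempty y.2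
  exact ⟨y.1 • p, mem_biUnion hy ⟨p, hp, rfl⟩⟩

theorem eval_basisElt (y : G × X) :
    h.eval (basisElt y) = (fun p : M => y.1 • p) '' (h.toFun y.2 : Set M) := by
  rw [ControlMap.eval, supp_basisElt, biUnion_singleton]

theorem eval_basisElt_subset {c : FreeMod G X} {y : G × X} (hy : y ∈ supp c) :
    h.eval (basisElt y) ⊆ h.eval c := by
  rw [eval_basisElt]
  exact subset_biUnion_of_mem (u := fun y : G × X => (fun p : M => y.1 • p) '' (h.toFun y.2 : Set M)) hy

theorem eval_map_subset (φ : FreeMod G X →+ FreeMod G X) (c : FreeMod G X) :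
    h.eval (φ c) ⊆ ⋃ y ∈ supp c, h.eval (φ (basisElt y)) := by
  intro p hp
  simp only [ControlMap.eval, mem_iUnion] at hp
  obtain ⟨z, hz, hp⟩ := hp
  obtain ⟨y, hy, hz'⟩ := mem_iUnion₂.1 (supp_map_subset φ c hz)
  exact mem_iUnion₂.2 ⟨y, hy, mem_iUnion₂.2 ⟨z, hz', hp⟩⟩

theorem eval_act_subset (g : G) (c : FreeMod G X) :
    h.eval (act g c) ⊆ (fun p : M => g • p) '' h.eval c := by
  intro p hp
  obtain ⟨y, hy, q, hq, rfl⟩ := mem_iUnion₂.1 hp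
  refine ⟨(g⁻¹ * y.1) • q, mem_iUnion₂.2 ⟨(g⁻¹ * y.1, y.2), ?_, q, hq, rfl⟩, ?_⟩
  · simpa only [mem_supp, coeff_act] using hy
  · simp [smul_smul]

/-- A property relating each point of `h(φ(c))` to some point of `h(c)` need only be checked
for `c` in the `ℤ`-basis `GX`. -/
theorem forall_eval_of_basisElt (φ : FreeMod G X →+ FreeMod G X) {P : M → M → Prop}
    (hP : ∀ y : G × X, ∀ p ∈ h.eval (φ (basisElt y)), ∃ q ∈ h.eval (basisElt y), P p q)
    (c : FreeMod G X) : ∀ p ∈ h.eval (φ c), ∃ q ∈ h.eval c, P p q := by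
  intro p hp
  obtain ⟨y, hy, hp⟩ := mem_iUnion₂.1 (eval_map_subset h φ c hp)
  obtain ⟨q, hq, hpq⟩ := hP y p hp
  exact ⟨q, eval_basisElt_subset h hy hq, hpq⟩

variable [MetricSpace M]

theorem exists_bound_of_controlNorm_lt_top {φ : FreeMod G X →+ FreeMod G X}
    (hφ : controlNorm h φ < ⊤) :
    ∃ r : ℝ≥0, ∀ c, ∀ p ∈ h.eval (φ c), ∃ q ∈ h.eval c, dist p q ≤ r := by
  simp only [controlNorm, iInf_lt_iff] at hφ
  obtain ⟨r, hr, -⟩ := hφ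
  exact ⟨r, hr⟩

theorem exists_diam_bound [Finite X] [IsIsometricSMul G M] :
    ∃ D : ℝ, ∀ y : G × X, ∀ p ∈ h.eval (basisElt y), ∀ q ∈ h.eval (basisElt y), dist p q ≤ D := by
  have hfin : (⋃ x, (h.toFun x : Set M)).Finite := finite_iUnion fun x => (h.toFun x).finite_toSet
  refine ⟨Metric.diam (⋃ x, (h.toFun x : Set M)), fun y p hp q hq => ?_⟩
  rw [eval_basisElt] at hp hq
  obtain ⟨p, hp, rfl⟩ := hp
  obtain ⟨q, hq, rfl⟩ := hq
  simp only [dist_smul]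
  exact Metric.dist_le_diam_of_mem hfin.isBounded (mem_iUnion.2 ⟨_, hp⟩) (mem_iUnion.2 ⟨_, hq⟩)

/-- A `G`-finitary endomorphism has finite norm: up to the action of `G`, only finitely many pairs of
points of `h(φ(y))` and `h(y)` occur for `y` in the `ℤ`-basis `GX`. -/
theorem IsFinitary.controlNorm_lt_top [Finite X] [IsIsometricSMul G M]
    {φ : FreeMod G X →+ FreeMod G X} (hφ : IsFinitary G φ) : controlNorm h φ < ⊤ := by
  obtain ⟨Φ, hfin, hequiv, hmem⟩ := hφ
  set B : Set M := (⋃ x, (h.toFun x : Set M)) ∪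
    ⋃ x : X, ⋃ b ∈ Φ (basisElt (1, x)), h.eval b
  have hBfin : B.Finite := (finite_iUnion fun x => (h.toFun x).finite_toSet).union
    (finite_iUnion fun x => (hfin _).biUnion fun b _ => finite_eval h b)
  have hr : ∀ c, ∀ p ∈ h.eval (φ c), ∃ q ∈ h.eval c, dist p q ≤ (Metric.diam B).toNNReal := by
    refine forall_eval_of_basisElt h φ ?_
    rintro ⟨g, x⟩ p hp
    have hg := hmem (basisElt (g, x))
    rw [← act_basisElt, hequiv] at hg
    obtain ⟨b, hb, hb'⟩ := hg
    rw [← act_basisElt, ← hb'] at hp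
    obtain ⟨p', hp', rfl⟩ := eval_act_subset h g b hp
    obtain ⟨q, hq⟩ := h.nonempty x
    refine ⟨g • q, ?_, ?_⟩
    · rw [eval_basisElt]; exact ⟨q, hq, rfl⟩
    · simp only [dist_smul]
      refine (Metric.dist_le_diam_of_mem hBfin.isBounded (Or.inr ?_) (Or.inl ?_)).trans
        (Real.le_coe_toNNReal _)
      · exact mem_iUnion.2 ⟨x, mem_iUnion₂.2 ⟨b, hb, hp'⟩⟩
      · exact mem_iUnion.2 ⟨x, hq⟩
  exact (iInf₂_le _ hr).trans_lt ENNReal.coe_lt_top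

theorem isFinitary_of_linear (φ : FreeMod G X →ₗ[MonoidAlgebra ℤ G] FreeMod G X) :
    IsFinitary G φ.toAddMonoidHom :=
  ⟨fun c => {φ c}, fun _ => finite_singleton _, fun g c => by simp [act], fun _ => rfl⟩

/-! ### Guaranteed shifts -/

theorem exists_valuation_eq (γ : Ray M) {c : FreeMod G X} (hc : c ≠ 0) :
    ∃ q ∈ h.eval c, valuation h γ c = (busemann γ q : EReal) := by
  obtain ⟨q, hq, hmin⟩ := (finite_eval h c).exists_minimalFor (busemann γ) _ (eval_nonempty h hc)
  refine ⟨q, hq, le_antisymm (iInf₂_le q hq) (le_iInf₂ fun p hp => ?_)⟩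
  exact EReal.coe_le_coe_iff.2 ((le_total _ _).elim id (hmin hp))

/-- As `h(c)` is finite, the minimum `v(c)` is attained, so the guaranteed shift is a condition on
points. It holds trivially at `c = 0`, where `h(φ(c))` is empty. -/
theorem le_gsh_iff (φ : FreeMod G X →+ FreeMod G X) (e : Boundary M) (δ : ℝ) :
    (δ : EReal) ≤ gsh h φ e ↔ ∀ c, ∀ p ∈ h.eval (φ c), ∃ q ∈ h.eval c,
      busemann e.ray q + δ ≤ busemann e.ray p := by
  rw [gsh, le_iInf₂_iff]
  constructor
  · intro H c p hp
    have hc : c ≠ 0 := by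
      rintro rfl
      simp [ControlMap.eval, supp_zero] at hp
    obtain ⟨q, hq, hv⟩ := exists_valuation_eq h e.ray hc
    refine ⟨q, hq, ?_⟩
    have h1 := H c hc
    rw [hv, EReal.le_sub_iff_add_le (by simp) (by simp)] at h1
    have h2 : valuation h e.ray (φ c) ≤ (busemann e.ray p : EReal) := iInf₂_le p hp
    have h3 := h1.trans h2
    rw [← EReal.coe_add, EReal.coe_le_coe_iff] at h3
    linarith
  · intro H c hc
    obtain ⟨q₀, -, hv⟩ := exists_valuation_eq h e.ray hc
    rw [hv, EReal.le_sub_iff_add_le (by simp) (by simp), ← hv]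
    refine le_iInf₂ fun p hp => ?_
    obtain ⟨q, hq, hpq⟩ := H c p hp
    have h1 : valuation h e.ray c ≤ (busemann e.ray q : EReal) := iInf₂_le q hq
    refine (add_le_add_right h1 (δ : EReal)).trans ?_
    rw [← EReal.coe_add, EReal.coe_le_coe_iff]
    linarith

theorem Boundary.endpoint_ray (e : Boundary M) : e.ray.endpoint = e := Quotient.out_eq e

theorem isOpen_pushSet [Finite X] [ProperSpace M] [IsIsometricSMul G M] (hM : IsCAT0 M)
    {φ : FreeMod G X →+ FreeMod G X} (hφ : controlNorm h φ < ⊤) :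
    IsOpen[angularTopology M] (pushSet h φ) := by
  intro e he
  obtain ⟨r, hr⟩ := exists_bound_of_controlNorm_lt_top h hφ
  obtain ⟨D, hD⟩ := exists_diam_bound (G := G) h
  obtain ⟨δ, hδ0, hδ⟩ := EReal.lt_iff_exists_real_btwn.1 (he : 0 < gsh h φ e)
  have hδ0' : 0 < δ := EReal.coe_pos.1 hδ0
  obtain ⟨θ, hθ, hbound⟩ := hM.exists_angle_bound (r + D) (half_pos hδ0')
  refine ⟨ENNReal.ofReal θ, ENNReal.ofReal_pos.2 hθ, fun e' he' => ?_⟩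
  have hang : angle e.ray.endpoint e'.ray.endpoint < θ := by
    rw [e.endpoint_ray, e'.endpoint_ray]
    exact (ENNReal.ofReal_lt_ofReal_iff hθ).1 he'
  refine (EReal.coe_pos.2 (half_pos hδ0')).trans_le ((le_gsh_iff h φ e' (δ / 2)).2 ?_)
  -- For `c` in the basis `GX`, the points `p ∈ h(φ(c))` and `q ∈ h(c)` are at bounded distance.
  refine forall_eval_of_basisElt h φ fun y p hp => ?_
  obtain ⟨q, hq, hpq⟩ := (le_gsh_iff h φ e δ).1 hδ.le _ p hp
  obtain ⟨q', hq', hpq'⟩ := hr _ p hp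
  refine ⟨q, hq, ?_⟩
  have hdist : dist q p ≤ r + D := by
    have h1 := dist_triangle p q' q
    have h2 := hD y q' hq' q hq
    rw [dist_comm]
    linarith
  have := hbound e.ray e'.ray hang q p hdist
  linarith

variable {A : Type*} [AddCommGroup A] [Module (MonoidAlgebra ℤ G) A]

theorem isOpen_finitarySigma [Finite X] [ProperSpace M] [IsIsometricSMul G M] (hM : IsCAT0 M)
    (ε : FreeMod G X →ₗ[MonoidAlgebra ℤ G] A) :
    IsOpen[angularTopology M] (finitarySigma ε h) := by
  rintro e ⟨φ, hφ, hε, he⟩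
  obtain ⟨r, hr0, hr⟩ := isOpen_pushSet h hM (hφ.controlNorm_lt_top h) e he
  exact ⟨r, hr0, fun e' he' => ⟨φ, hφ, hε, hr e' he'⟩⟩

theorem isOpen_equivariantSigma [Finite X] [ProperSpace M] [IsIsometricSMul G M] (hM : IsCAT0 M)
    (ε : FreeMod G X →ₗ[MonoidAlgebra ℤ G] A) :
    IsOpen[angularTopology M] (equivariantSigma ε h) := by
  rintro e ⟨φ, hε, he⟩
  obtain ⟨r, hr0, hr⟩ :=
    isOpen_pushSet h hM ((isFinitary_of_linear φ).controlNorm_lt_top h) e he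
  exact ⟨r, hr0, fun e' he' => ⟨φ, hε, hr e' he'⟩⟩

end Algebra

end LimitSets

end

/-- `ε : F_X → A` is an arbitrary finitely generated free presentation of the `G`-module `A`, and
`h` an arbitrary control map on `F_X`. -/
theorem theorem2p11 {G : Type*} [Group G]
    {M : Type*} [MetricSpace M] [ProperSpace M] (hM : LimitSets.IsCAT0 M)
    [MulAction G M] [IsIsometricSMul G M]
    {A : Type*} [AddCommGroup A] [Module (MonoidAlgebra ℤ G) A] [Module.Finite (MonoidAlgebra ℤ G) A]
    {X : Type*} [Finite X]
    (ε : LimitSets.FreeMod G X →ₗ[MonoidAlgebra ℤ G] A) (hε : Function.Surjective ε)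
    (h : LimitSets.ControlMap X M) :
    (IsOpen[LimitSets.angularTopology M] (LimitSets.finitarySigma ε h) ∧
      IsOpen[LimitSets.angularTopology M] (LimitSets.equivariantSigma ε h) ∧
      ∀ φ : LimitSets.FreeMod G X →+ LimitSets.FreeMod G X, LimitSets.controlNorm h φ < ⊤ →
        IsOpen[LimitSets.angularTopology M] (LimitSets.pushSet h φ)) ∧
    (IsOpen[LimitSets.titsTopology M] (LimitSets.finitarySigma ε h) ∧
      IsOpen[LimitSets.titsTopology M] (LimitSets.equivariantSigma ε h) ∧
      ∀ φ : LimitSets.FreeMod G X →+ LimitSets.FreeMod G X, LimitSets.controlNorm h φ < ⊤ →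
        IsOpen[LimitSets.titsTopology M] (LimitSets.pushSet h φ)) := by
  have hpush : ∀ φ : LimitSets.FreeMod G X →+ LimitSets.FreeMod G X,
      LimitSets.controlNorm h φ < ⊤ →
        IsOpen[LimitSets.angularTopology M] (LimitSets.pushSet h φ) :=
    fun φ hφ => LimitSets.isOpen_pushSet h hM hφ
  have hfin := LimitSets.isOpen_finitarySigma h hM ε
  have hequiv := LimitSets.isOpen_equivariantSigma h hM ε
  exact ⟨⟨hfin, hequiv, hpush⟩, LimitSets.isOpen_titsTopology_of_angularTopology hfin,
    LimitSets.isOpen_titsTopology_of_angularTopology hequiv,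
    fun φ hφ => LimitSets.isOpen_titsTopology_of_angularTopology (hpush φ hφ)⟩
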